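/- For $n\ge 0$ let $C_n=(\mathbb Z/2)^n\rtimes \mathfrak S_n$ be the group of signed permutations of $n$ coordinates (the symmetry group of the $n$-cube), let $D_n\le C_n$ be the subgroup of signed permutations with an even number of coordinate inversions, and let $A_n=\mathfrak S_{n+1}$ (the symmetry group of the $n$-simplex). For a finite group $G$ with centre $Z(G)$, let $$\mathbb P_{\varphi\in\mathrm{End}(G)}\big[Z(G)\subseteq\ker\varphi\big]=\frac{|\{\varphi\in\mathrm{End}(G): Z(G)\subseteq\ker\varphi\}|}{|\mathrm{End}(G)|}$$ be the probability that $Z(G)$ lies in the kernel of a uniformly random group endomorphism of $G$. Then $$\lim_{n\to\infty}\mathbb P_{\varphi\in\mathrm{End}(W_n)}\big[Z(W_n)\subseteq\ker\varphi\big]=\begin{cases}\tfrac12 & \text{if } W_n=C_n \text{ (all } n) \text{ or } W_n=D_{2n},\\ 1 & \text{if } W_n=D_{2n+1} \text{ or } W_n=A_n.\end{cases}$$ Moreover, the centre of $D_{2n+1}$ is trivial for $n\ge1$ and the centre of $A_n$ is trivial for $n\ge2$. -/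

import Mathlib

open Filter Topology

/-- The reflection group of type `C_n`, as the group `(C₂)ⁿ ⋊ S_n` of signed permutations of `n`
coordinates (the symmetry group of the `n`-cube). The element `⟨x, σ⟩` acts on `ℝⁿ` by
`e_i ↦ x_{σ i} e_{σ i}`; the symmetric group acts on sign vectors by permuting coordinates. -/
abbrev TypeC (n : ℕ) : Type :=
  (Fin n → ℤˣ) ⋊[(mulAutArrow : Equiv.Perm (Fin n) →* MulAut (Fin n → ℤˣ))] Equiv.Perm (Fin n)

/-- The homomorphism `⟨x, σ⟩ ↦ ∏ i, x i = (-1) ^ (number of coordinate inversions)`. -/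
def inversionSign (n : ℕ) : TypeC n →* ℤˣ where
  toFun w := ∏ i, w.left i
  map_one' := by simp
  map_mul' v w := by
    have h : ∏ i, w.left (v.right⁻¹ • i) = ∏ i, w.left i :=
      Equiv.prod_comp (v.right⁻¹ : Equiv.Perm (Fin n)) w.left
    simp only [SemidirectProduct.mul_left, Pi.mul_apply, Finset.prod_mul_distrib]
    exact congrArg _ h

/-- The reflection group of type `D_n`: the signed permutations of `n` coordinates with an even
number of coordinate inversions. -/
abbrev TypeD (n : ℕ) : Type := (inversionSign n).ker

/-- The reflection group of type `A_n`: the symmetric group on `n + 1` letters (the symmetry group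
of the `n`-simplex). -/
abbrev TypeA (n : ℕ) : Type := Equiv.Perm (Fin (n + 1))

instance (n : ℕ) : Finite (TypeC n) := Finite.of_equiv _ SemidirectProduct.equivProd.symm

/-- The probability that the centre of the finite group `G` is contained in the kernel of an
endomorphism of `G` drawn uniformly at random. -/
noncomputable def probCenterLeKer (G : Type) [Group G] [Finite G] : ℝ :=
  (Nat.card {φ : G →* G // Subgroup.center G ≤ φ.ker} : ℝ) / (Nat.card (G →* G) : ℝ)

/-!
Let `z` be the nontrivial central element and `p` the projection of `C_n` or `D_{2m}` onto `S_n`.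
Call an endomorphism `φ` standard if `p ∘ φ` is `p` followed by an inner automorphism of `S_n`; then
`φ z` is `1` or `z`. Multiplying a standard `φ` by a conjugate of the retraction onto the (abelian,
exponent two) kernel of `p` is an involution exchanging these two cases, so exactly half of the
standard endomorphisms kill the centre, and there are at least `n!` of them.

For `n ≥ 7` every endomorphism of `S_n` that is not inner kills `A_n`: an automorphism maps
transpositions to transpositions, because these are the involutions `t ≠ 1` all of whose
commutators satisfy `⁅t, g⁆ ^ 6 = 1`. Since `A_n` is generated by 3-cycles, which have no nontrivial
image in a group of exponent two, a nonstandard endomorphism kills the copy of `A_n`. It is then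
determined by its values on two commuting involutions that generate the group together with this
copy. So there are at most `16 ^ n * |Hom((ℤ/2)², S_n)|` nonstandard endomorphisms, which is
`o(n!)`: splitting off the orbit of a point gives a recurrence that forces `|Hom(Q, S_n)| / n!` to
decay superexponentially, for every finite group `Q`.
-/

section ActionCount

open Equiv MulAction

instance {G H : Type*} [Group G] [Group H] [Finite G] [Finite H] : Finite (G →* H) :=
  DFunLike.finite _

variable {G α : Type*} [Group G]

/-- The action of `G` on `α` glued from a copy of the coset action on `G ⧸ H`, embedded by `e`, and
an action `θ` on the complement; every action on a pointed set is of this form. -/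
noncomputable def glueAction {H : Subgroup G} (e : G ⧸ H ↪ α)
    (θ : G →* Perm {a // a ∉ Set.range e}) : G →* Perm α :=
  open Classical in
  (Perm.subtypeCongrHom (fun a => a ∈ Set.range e)).comp
    (((Equiv.ofInjective e e.injective).permCongrHom.toMonoidHom.comp
      (toPermHom G (G ⧸ H))).prod θ)

theorem glueAction_apply_mem {H : Subgroup G} (e : G ⧸ H ↪ α)
    (θ : G →* Perm {a // a ∉ Set.range e}) (g : G) (q : G ⧸ H) :
    glueAction e θ g (e q) = e (g • q) := by
  classical
  refine (Perm.subtypeCongr.left_apply _ _ ⟨q, rfl⟩).trans (congrArg e ?_)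
  exact congrArg (g • ·) (Equiv.ofInjective_symm_apply e.injective q)

theorem glueAction_apply_notMem {H : Subgroup G} (e : G ⧸ H ↪ α)
    (θ : G →* Perm {a // a ∉ Set.range e}) (g : G) {a : α} (ha : a ∉ Set.range e) :
    glueAction e θ g a = θ g ⟨a, ha⟩ := by
  classical exact Perm.subtypeCongr.right_apply _ _ ha

theorem exists_glueAction_eq (ρ : G →* Perm α) (x : α) :
    ∃ (H : Subgroup G) (e : G ⧸ H ↪ α) (θ : G →* Perm {a // a ∉ Set.range e}),
      e (1 : G) = x ∧ glueAction e θ = ρ := by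
  let _ : MulAction G α := MulAction.compHom α ρ
  let e : G ⧸ stabilizer G x ↪ α :=
    ⟨ofQuotientStabilizer G x, injective_ofQuotientStabilizer G x⟩
  have he (g : G) (q : G ⧸ stabilizer G x) : e (g • q) = ρ g (e q) :=
    ofQuotientStabilizer_smul G x g q
  have range_iff (g : G) (a : α) : ρ g a ∉ Set.range e ↔ a ∉ Set.range e := by
    refine not_congr ⟨?_, ?_⟩
    · rintro ⟨q, hq⟩
      exact ⟨g⁻¹ • q, by rw [he, hq, ← Perm.mul_apply, ← map_mul, inv_mul_cancel, map_one,
        Perm.one_apply]⟩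
    · rintro ⟨q, rfl⟩
      exact ⟨g • q, he g q⟩
  let θ : G →* Perm {a // a ∉ Set.range e} :=
    MonoidHom.mk' (fun g => (ρ g).subtypePerm (range_iff g)) fun g h => by
      rw [Perm.subtypePerm_mul]; congr 1; exact map_mul ρ g h
  refine ⟨stabilizer G x, e, θ, (ofQuotientStabilizer_mk G x 1).trans (one_smul G x), ?_⟩
  ext g a
  by_cases ha : a ∈ Set.range e
  · obtain ⟨q, rfl⟩ := ha
    rw [glueAction_apply_mem, he]
  · rw [glueAction_apply_notMem e θ g ha]
    rfl

theorem card_monoidHom_perm_congr {β : Type*} (e : α ≃ β) :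
    Nat.card (G →* Perm α) = Nat.card (G →* Perm β) :=
  Nat.card_congr e.permCongrHom.monoidHomCongrRightEquiv

theorem card_monoidHom_perm_compl_range [Finite α] {H : Subgroup G} (e : G ⧸ H ↪ α) :
    Nat.card (G →* Perm {a // a ∉ Set.range e}) =
      Nat.card (G →* Perm (Fin (Nat.card α - H.index))) := by
  have hcard : Nat.card {a // a ∉ Set.range e} = Nat.card α - H.index := by
    have := Finite.of_injective e e.injective
    rw [Subgroup.index, ← Set.ncard_range_of_injective e.injective, ← Set.ncard_compl]
    exact Nat.card_coe_set_eq _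
  exact card_monoidHom_perm_congr (Finite.equivFinOfCardEq hcard)

theorem card_mul_card_monoidHom_perm_le [Finite G] [Fintype (Subgroup G)] (n : ℕ) :
    n * Nat.card (G →* Perm (Fin n)) ≤
      ∑ H : Subgroup G, n.descFactorial H.index * Nat.card (G →* Perm (Fin (n - H.index))) := by
  let Ψ : (Σ (H : Subgroup G) (e : G ⧸ H ↪ Fin n), G →* Perm {a // a ∉ Set.range e}) →
      Fin n × (G →* Perm (Fin n)) := fun d => (d.2.1 (1 : G), glueAction d.2.1 d.2.2)
  have hΨ : Function.Surjective Ψ := fun ⟨x, ρ⟩ => by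
    obtain ⟨H, e, θ, hx, hρ⟩ := exists_glueAction_eq ρ x
    exact ⟨⟨H, e, θ⟩, Prod.ext hx hρ⟩
  have hemb (H : Subgroup G) : Nat.card (G ⧸ H ↪ Fin n) = n.descFactorial H.index := by
    classical
    have := Fintype.ofFinite (G ⧸ H)
    rw [Nat.card_eq_fintype_card, Fintype.card_embedding_eq, Fintype.card_fin, Subgroup.index,
      Nat.card_eq_fintype_card]
  have hcompl (H : Subgroup G) (e : G ⧸ H ↪ Fin n) :
      Nat.card (G →* Perm {a // a ∉ Set.range e}) =
        Nat.card (G →* Perm (Fin (n - H.index))) := by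
    rw [card_monoidHom_perm_compl_range, Nat.card_fin]
  have (H : Subgroup G) := Fintype.ofFinite (G ⧸ H ↪ Fin n)
  calc n * Nat.card (G →* Perm (Fin n)) = Nat.card (Fin n × (G →* Perm (Fin n))) := by
        rw [Nat.card_prod, Nat.card_fin]
    _ ≤ Nat.card (Σ (H : Subgroup G) (e : G ⧸ H ↪ Fin n), G →* Perm {a // a ∉ Set.range e}) :=
        Nat.card_le_card_of_surjective Ψ hΨ
    _ = ∑ H : Subgroup G, n.descFactorial H.index *
          Nat.card (G →* Perm (Fin (n - H.index))) := by
      simp only [Nat.card_sigma, hcompl, Finset.sum_const, Finset.card_univ, smul_eq_mul,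
        ← Nat.card_eq_fintype_card, hemb]

end ActionCount

section Decay

variable {ι : Type*} [Fintype ι] {k : ι → ℕ} {u : ℕ → ℝ}

theorem exists_forall_pow_mul_le_of_recurrence (hk : ∀ i, 0 < k i) (hu : ∀ n, 0 ≤ u n)
    (hrec : ∀ n : ℕ, n * u n ≤ ∑ i, if k i ≤ n then u (n - k i) else 0) {r : ℝ} (hr : 0 ≤ r) :
    ∃ C, ∀ n, r ^ n * u n ≤ C := by
  obtain ⟨N, hN⟩ := exists_nat_gt (∑ i, r ^ k i)
  have hv (n : ℕ) : 0 ≤ r ^ n * u n := mul_nonneg (pow_nonneg hr n) (hu n)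
  set C := ∑ m ∈ Finset.range N, r ^ m * u m
  have hC : 0 ≤ C := Finset.sum_nonneg fun m _ => hv m
  refine ⟨C, fun n => ?_⟩
  induction n using Nat.strong_induction_on with
  | _ n ih =>
  rcases lt_or_ge n N with hn | hn
  · exact Finset.single_le_sum (fun m _ => hv m) (Finset.mem_range.2 hn)
  · have hn' : ∑ i, r ^ k i < n := hN.trans_le (Nat.cast_le.2 hn)
    have hn0 : (0 : ℝ) < n := (Finset.sum_nonneg fun i _ => pow_nonneg hr (k i)).trans_lt hn'
    refine le_of_mul_le_mul_left ?_ hn0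
    calc n * (r ^ n * u n) = r ^ n * (n * u n) := by ring
      _ ≤ r ^ n * ∑ i, if k i ≤ n then u (n - k i) else 0 := by gcongr; exact hrec n
      _ = ∑ i, r ^ n * if k i ≤ n then u (n - k i) else 0 := Finset.mul_sum ..
      _ ≤ ∑ i, r ^ k i * C := Finset.sum_le_sum fun i _ => by
        split_ifs with hi
        · rw [← pow_mul_pow_sub r hi, mul_assoc]
          gcongr
          exact ih _ (Nat.sub_lt (Nat.cast_pos.1 hn0) (hk i))
        · rw [mul_zero]
          positivity
      _ = (∑ i, r ^ k i) * C := (Finset.sum_mul ..).symm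
      _ ≤ n * C := by gcongr

theorem tendsto_pow_mul_of_recurrence (hk : ∀ i, 0 < k i) (hu : ∀ n, 0 ≤ u n)
    (hrec : ∀ n : ℕ, n * u n ≤ ∑ i, if k i ≤ n then u (n - k i) else 0) {r : ℝ} (hr : 0 ≤ r) :
    Tendsto (fun n => r ^ n * u n) atTop (𝓝 0) := by
  obtain ⟨C, hC⟩ := exists_forall_pow_mul_le_of_recurrence hk hu hrec
    (mul_nonneg zero_le_two hr)
  have hlim : Tendsto (fun n : ℕ => (1 / 2 : ℝ) ^ n * C) atTop (𝓝 0) := by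
    simpa using (tendsto_pow_atTop_nhds_zero_of_lt_one (by norm_num) one_half_lt_one).mul_const C
  refine squeeze_zero (fun n => mul_nonneg (pow_nonneg hr n) (hu n)) (fun n => ?_) hlim
  calc r ^ n * u n = (1 / 2) ^ n * ((2 * r) ^ n * u n) := by
        rw [← mul_assoc, ← mul_pow]; ring_nf
    _ ≤ (1 / 2) ^ n * C := by gcongr; exact hC n

end Decay

open Equiv in
theorem tendsto_pow_mul_card_monoidHom_perm_div_factorial (G : Type*) [Group G] [Finite G]
    {r : ℝ} (hr : 0 ≤ r) :
    Tendsto (fun n => r ^ n * (Nat.card (G →* Perm (Fin n)) / n.factorial)) atTop (𝓝 0) := by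
  have := Fintype.ofFinite (Subgroup G)
  refine tendsto_pow_mul_of_recurrence (ι := Subgroup G) (k := Subgroup.index)
    (fun H => Nat.pos_of_ne_zero H.index_ne_zero_of_finite) (fun n => by positivity)
    (fun n => ?_) hr
  rw [← mul_div_assoc, div_le_iff₀ (by positivity), Finset.sum_mul]
  calc (n * Nat.card (G →* Perm (Fin n)) : ℝ)
      ≤ ∑ H : Subgroup G, (n.descFactorial H.index : ℝ) *
          Nat.card (G →* Perm (Fin (n - H.index))) := mod_cast card_mul_card_monoidHom_perm_le n
    _ = _ := Finset.sum_congr rfl fun H _ => by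
      split_ifs with hH
      · rw [← Nat.factorial_mul_descFactorial hH, Nat.cast_mul]
        field_simp
      · rw [Nat.descFactorial_of_lt (not_le.1 hH), Nat.cast_zero, zero_mul, zero_mul]

section SymmetricGroup

open Equiv Equiv.Perm commutatorElement

variable {α : Type*}

theorem commutatorElement_apply_of_mul_self {t : Perm α} (ht : t * t = 1) (g : Perm α) (x : α) :
    ⁅t, g⁆ (g x) = t (g (t x)) := by
  rw [commutatorElement_def, inv_eq_of_mul_eq_one_left ht]
  simp

theorem exists_commutatorElement_pow_six_ne_one_of_fixed {t : Perm α} (ht : t * t = 1)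
    {a c e : α} (hac : a ≠ c) (ha : t a ≠ a) (hc : t c ≠ c) (hca : t a ≠ c)
    (he : t e = e) : ∃ g : Perm α, ⁅t, g⁆ ^ 6 ≠ 1 := by
  classical
  obtain ⟨b, hb⟩ : ∃ b, t a = b := ⟨_, rfl⟩
  obtain ⟨d, hd⟩ : ∃ d, t c = d := ⟨_, rfl⟩
  have htb : t b = a := hb ▸ congrArg (· a) ht
  have htd : t d = c := hd ▸ congrArg (· c) ht
  obtain ⟨g, ga, gb, gc, gd, ge⟩ : ∃ g : Perm α, g a = c ∧ g b = b ∧ g c = e ∧ g d = d ∧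
      g e = a := by
    refine ⟨swap a c * swap c e, ?_⟩
    simp only [Perm.mul_apply]
    grind only [swap_apply_def]
  have hw {x y u v : α} (hx : g x = y) (hu : g (t x) = u) (hv : t u = v) : ⁅t, g⁆ y = v := by
    rw [← hx, commutatorElement_apply_of_mul_self ht, hu, hv]
  have hwa : ⁅t, g⁆ a = b := hw ge (he.symm ▸ ge) hb
  have hwb : ⁅t, g⁆ b = d := hw gb (htb.symm ▸ ga) hd
  have hwd : ⁅t, g⁆ d = e := hw gd (htd.symm ▸ gc) he
  have hwe : ⁅t, g⁆ e = c := hw gc (hd.symm ▸ gd) htd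
  have hwc : ⁅t, g⁆ c = a := hw ga (hb.symm ▸ gb) htb
  refine ⟨g, fun h => ha ?_⟩
  have := congrArg (· a) h
  simp only [pow_succ, pow_zero, one_mul, Perm.mul_apply, hwa, hwb, hwd, hwe, hwc,
    Perm.one_apply] at this
  exact hb.trans this

theorem exists_commutatorElement_pow_six_ne_one_of_forall_ne {t : Perm α} (ht : t * t = 1)
    (hfix : ∀ x, t x ≠ x) [Finite α] (hα : 7 ≤ Nat.card α) : ∃ g : Perm α, ⁅t, g⁆ ^ 6 ≠ 1 := by
  classical
  have := Fintype.ofFinite α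
  have htt (x : α) : t (t x) = x := congrArg (· x) ht
  rw [Nat.card_eq_fintype_card] at hα
  have pick (s : Finset α) (hs : s.card < 7) : ∃ x, x ∉ s := by
    simpa using Finset.exists_mem_notMem_of_card_lt_card (hs.trans_le hα)
  obtain ⟨a, -⟩ := pick ∅ (by simp)
  obtain ⟨b, hb⟩ := pick {a, t a} (Finset.card_le_two.trans_lt (by decide))
  obtain ⟨c, hc⟩ := pick {a, t a, b, t b} (Finset.card_le_four.trans_lt (by decide))
  obtain ⟨d, hd⟩ := pick {a, t a, b, t b, c, t c} (Finset.card_le_six.trans_lt (by decide))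
  simp only [Finset.mem_insert, Finset.mem_singleton, not_or] at hb hc hd
  obtain ⟨g, ga, gb, gc, gd, gta, gtb, gtc, gtd⟩ : ∃ g : Perm α,
      g a = b ∧ g b = c ∧ g c = d ∧ g d = a ∧
      g (t a) = t a ∧ g (t b) = t b ∧ g (t c) = t c ∧ g (t d) = t d := by
    refine ⟨swap a b * swap b c * swap c d, ?_⟩
    simp only [Perm.mul_apply]
    clear ht pick
    grind only [swap_apply_def]
  have hw {x y u v : α} (hx : g x = y) (hu : g (t x) = u) (hv : t u = v) : ⁅t, g⁆ y = v := by
    rw [← hx, commutatorElement_apply_of_mul_self ht, hu, hv]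
  have hwa : ⁅t, g⁆ a = d := hw gd gtd (htt d)
  have hwb : ⁅t, g⁆ b = a := hw ga gta (htt a)
  have hwc : ⁅t, g⁆ c = b := hw gb gtb (htt b)
  have hwd : ⁅t, g⁆ d = c := hw gc gtc (htt c)
  refine ⟨g, fun h => hc.1 ?_⟩
  have := congrArg (· a) h
  simp only [pow_succ, pow_zero, one_mul, Perm.mul_apply, hwa, hwb, hwd, hwc,
    Perm.one_apply] at this
  exact this

theorem center_perm_eq_bot [Finite α] (hα : 3 ≤ Nat.card α) : Subgroup.center (Perm α) = ⊥ := by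
  have := Fintype.ofFinite α
  classical
  rw [Nat.card_eq_fintype_card] at hα
  rw [Subgroup.eq_bot_iff_forall]
  refine fun τ hτ => Perm.ext fun x => by_contra fun hx : τ x ≠ x => ?_
  obtain ⟨y, hyx, hyτ⟩ : ∃ y, y ≠ x ∧ y ≠ τ x := by
    simpa using Finset.exists_mem_notMem_of_card_lt_card
      ((Finset.card_le_two (a := x) (b := τ x)).trans_lt hα)
  have h := Perm.ext_iff.1 (Subgroup.mem_center_iff.1 hτ (swap x y)) x
  rw [Perm.mul_apply, Perm.mul_apply, swap_apply_left, swap_apply_of_ne_of_ne hx hyτ.symm] at h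
  exact hyx (τ.injective h).symm

variable [DecidableEq α]

theorem eq_swap_apply_of_isSwap {s : Perm α} (hs : s.IsSwap) {x : α} (hx : s x ≠ x) :
    s = swap x (s x) := by
  obtain ⟨y, z, -, rfl⟩ := hs
  obtain ⟨-, rfl | rfl⟩ := swap_apply_ne_self_iff.1 hx
  · rw [swap_apply_left]
  · rw [swap_apply_right, swap_comm]

theorem exists_eq_swap_of_not_commute {s t : Perm α} (hs : s.IsSwap) (ht : t.IsSwap)
    (hst : ¬Commute s t) :
    ∃ p a b, p ≠ a ∧ p ≠ b ∧ a ≠ b ∧ s = swap p a ∧ t = swap p b := by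
  obtain ⟨p, hps, hpt⟩ : ∃ p, s p ≠ p ∧ t p ≠ p := by
    by_contra! h
    exact hst (disjoint_iff_eq_or_eq.2 fun x => or_iff_not_imp_left.2 (h x)).commute
  have hs' := eq_swap_apply_of_isSwap hs hps
  have ht' := eq_swap_apply_of_isSwap ht hpt
  refine ⟨p, s p, t p, hps.symm, hpt.symm, fun h => hst ?_, hs', ht'⟩
  rw [hs', ht', h]

theorem mul_pow_six_of_isSwap [Finite α] {s t : Perm α} (hs : s.IsSwap) (ht : t.IsSwap) :
    (s * t) ^ 6 = 1 := by
  have := Fintype.ofFinite α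
  rw [← orderOf_dvd_iff_pow_eq_one]
  by_cases hst : Commute s t
  · refine hst.orderOf_mul_dvd_lcm.trans ?_
    rw [hs.orderOf, ht.orderOf]
    decide
  · obtain ⟨p, a, b, hpa, hpb, hab, rfl, rfl⟩ := exists_eq_swap_of_not_commute hs ht hst
    rw [(isThreeCycle_swap_mul_swap_same hpa hpb hab).orderOf]
    decide

theorem commutatorElement_pow_six_of_isSwap [Finite α] {s : Perm α} (hs : s.IsSwap)
    (g : Perm α) : ⁅s, g⁆ ^ 6 = 1 := by
  obtain ⟨x, y, hxy, rfl⟩ := hs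
  have hconj : ⁅swap x y, g⁆ = swap x y * swap (g x) (g y) := by
    rw [commutatorElement_def, swap_apply_apply, swap_inv, mul_assoc, mul_assoc, mul_assoc]
  rw [hconj]
  exact mul_pow_six_of_isSwap ⟨x, y, hxy, rfl⟩ ⟨g x, g y, g.injective.ne hxy, rfl⟩

theorem isSwap_of_forall_commutatorElement_pow_six [Finite α] (hα : 7 ≤ Nat.card α)
    {t : Perm α} (ht : t * t = 1) (ht1 : t ≠ 1) (h : ∀ g : Perm α, ⁅t, g⁆ ^ 6 = 1) : t.IsSwap := by
  have htt (x : α) : t (t x) = x := congrArg (· x) ht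
  by_contra! hswap
  obtain ⟨a, ha⟩ : ∃ a, t a ≠ a := by
    by_contra! hfix
    exact ht1 (Perm.ext hfix)
  obtain ⟨c, hc, hca⟩ : ∃ c, t c ≠ c ∧ c ≠ a ∧ t a ≠ c := by
    by_contra! hsupp
    refine hswap ⟨a, t a, ha.symm, Perm.ext fun x => ?_⟩
    grind only [swap_apply_def]
  obtain ⟨g, hg⟩ : ∃ g : Perm α, ⁅t, g⁆ ^ 6 ≠ 1 := by
    by_cases hfix : ∃ e, t e = e
    · obtain ⟨e, he⟩ := hfix
      exact exists_commutatorElement_pow_six_ne_one_of_fixed ht hca.1.symm ha hc hca.2 he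
    · push Not at hfix
      exact exists_commutatorElement_pow_six_ne_one_of_forall_ne ht hfix hα
  exact hg (h g)

theorem isSwap_map_of_bijective [Finite α] (hα : 7 ≤ Nat.card α) {f : Perm α →* Perm α}
    (hf : Function.Bijective f) {s : Perm α} (hs : s.IsSwap) : (f s).IsSwap := by
  have hss : s * s = 1 := by
    rw [← pow_two, ← hs.orderOf, pow_orderOf_eq_one]
  have hs1 : s ≠ 1 := fun h => by
    simpa [h] using hs.orderOf
  refine isSwap_of_forall_commutatorElement_pow_six hα (by rw [← map_mul, hss, map_one])
    ((map_ne_one_iff f hf.injective).2 hs1) fun g => ?_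
  obtain ⟨g, rfl⟩ := hf.surjective g
  rw [← map_commutatorElement, ← map_pow, commutatorElement_pow_six_of_isSwap hs, map_one]

theorem swap_eq_conj_swap {x i j : α} (hj : j ≠ x) (hij : i ≠ j) :
    swap i j = swap x i * swap x j * (swap x i)⁻¹ := by
  rw [← swap_apply_apply, swap_apply_left, swap_apply_of_ne_of_ne hj hij.symm]

theorem monoidHom_perm_ext [Finite α] {G : Type*} [Group G] {f g : Perm α →* G} (x : α)
    (h : ∀ i, f (swap x i) = g (swap x i)) : f = g := by
  refine MonoidHom.eq_of_eqOn_dense (closure_isSwap (α := α)) ?_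
  rintro _ ⟨i, j, hij, rfl⟩
  by_cases hj : j = x
  · rw [hj, swap_comm]
    exact h i
  · simp only [swap_eq_conj_swap hj hij, map_mul, map_inv, h]

theorem not_commute_swap_swap {x i j : α} (hi : x ≠ i) (hj : x ≠ j) (hij : i ≠ j) :
    ¬Commute (swap x i) (swap x j) := fun h => by
  have := Perm.ext_iff.1 h.eq x
  simp only [Perm.mul_apply, swap_apply_left, swap_apply_of_ne_of_ne hj.symm hij.symm,
    swap_apply_of_ne_of_ne hi.symm hij] at this
  exact hij this.symm

theorem swap_apply_ne_or_eq_swap {s : Perm α} (hs : s.IsSwap) {p a b : α} (hab : a ≠ b)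
    (ha : ¬Commute s (swap p a)) (hb : ¬Commute s (swap p b)) :
    s p ≠ p ∨ s = swap a b := by
  refine or_iff_not_imp_left.2 fun hp => ?_
  push Not at hp
  obtain ⟨x, y, hxy, rfl⟩ := hs
  have moves {q : α} (h : ¬Commute (swap x y) (swap p q)) : swap x y q ≠ q := fun hq =>
    h <| (disjoint_iff_eq_or_eq.2 fun z => by grind only [swap_apply_def]).commute
  have hxa := moves ha
  have hxb := moves hb
  ext z
  grind only [swap_apply_def]

/-- A family of transpositions that pairwise fail to commute is a star or a triangle; the images of
the star `swap x k`, `k ≠ x`, cannot form a triangle, since its third edge is already the image of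
some `swap i j`. -/
theorem exists_forall_map_swap_apply_ne [Finite α] (hα : 3 ≤ Nat.card α) {f : Perm α →* Perm α}
    (hf : Function.Injective f) (hswap : ∀ s : Perm α, s.IsSwap → (f s).IsSwap) :
    ∃ x p : α, ∀ k, x ≠ k → f (swap x k) p ≠ p := by
  have := Fintype.ofFinite α
  rw [Nat.card_eq_fintype_card] at hα
  obtain ⟨x, i, j, hxi, hxj, hij⟩ := Fintype.two_lt_card_iff.1 hα
  have hS {k : α} (hk : x ≠ k) : (f (swap x k)).IsSwap := hswap _ ⟨x, k, hk, rfl⟩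
  have hcomm {k l : α} (hk : x ≠ k) (hl : x ≠ l) (hkl : k ≠ l) :
      ¬Commute (f (swap x k)) (f (swap x l)) := fun h =>
    not_commute_swap_swap hk hl hkl (h.of_map hf)
  obtain ⟨p, a, b, hpa, hpb, hab, ha, hb⟩ :=
    exists_eq_swap_of_not_commute (hS hxi) (hS hxj) (hcomm hxi hxj hij)
  refine ⟨x, p, fun k hk => ?_⟩
  by_cases hki : k = i
  · rw [hki, ha, swap_apply_left]
    exact hpa.symm
  by_cases hkj : k = j
  · rw [hkj, hb, swap_apply_left]
    exact hpb.symm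
  refine (swap_apply_ne_or_eq_swap (hS hk) hab (ha ▸ hcomm hk hxi hki)
    (hb ▸ hcomm hk hxj hkj)).resolve_right fun htriangle => ?_
  have hthird : f (swap i j) = swap a b := by
    rw [swap_eq_conj_swap hxj.symm hij, map_mul, map_mul, map_inv, ha, hb,
      ← swap_eq_conj_swap hpb.symm hab]
  have := Perm.ext_iff.1 (hf (htriangle.trans hthird.symm)) x
  rw [swap_apply_left, swap_apply_of_ne_of_ne hxi hxj] at this
  exact hk this.symm

theorem exists_eq_conj_of_isSwap_map [Finite α] (hα : 3 ≤ Nat.card α) {f : Perm α →* Perm α}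
    (hf : Function.Injective f) (hswap : ∀ s : Perm α, s.IsSwap → (f s).IsSwap) :
    ∃ τ : Perm α, f = (MulAut.conj τ).toMonoidHom := by
  obtain ⟨x, p, hmoves⟩ := exists_forall_map_swap_apply_ne hα hf hswap
  let τ (k : α) : α := f (swap x k) p
  have hτ (k : α) : f (swap x k) = swap p (τ k) := by
    by_cases hk : x = k
    · simp [τ, hk, ← Perm.one_def]
    · exact eq_swap_apply_of_isSwap (hswap _ ⟨x, k, hk, rfl⟩) (hmoves k hk)
  have hinj : Function.Injective τ := fun k l hkl => by
    have := hf ((hτ k).trans (hkl ▸ (hτ l).symm))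
    simpa only [swap_apply_left] using Perm.ext_iff.1 this x
  have hx : τ x = p := by simp [τ, ← Perm.one_def]
  refine ⟨Equiv.ofBijective τ (Finite.injective_iff_bijective.1 hinj), ?_⟩
  refine monoidHom_perm_ext x fun k => ?_
  rw [hτ, ← hx]
  exact swap_apply_apply (Equiv.ofBijective τ _) x k

theorem alternatingGroup_le_ker_or_exists_eq_conj [Fintype α] (hα : 7 ≤ Nat.card α)
    (f : Perm α →* Perm α) :
    alternatingGroup α ≤ f.ker ∨ ∃ τ : Perm α, f = (MulAut.conj τ).toMonoidHom := by
  by_cases hf : Function.Injective f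
  · exact Or.inr (exists_eq_conj_of_isSwap_map (by lia) hf fun s =>
      isSwap_map_of_bijective hα (Finite.injective_iff_bijective.1 hf))
  · refine Or.inl (alternatingGroup_le_of_normal (by lia) ?_)
    rwa [Subgroup.nontrivial_iff_ne_bot, Ne, MonoidHom.ker_eq_bot_iff]

end SymmetricGroup

section Halving

theorem two_mul_ncard_of_involutive {Y : Type*} [Finite Y] {Q : Set Y} {F : Y → Y}
    (hF : Function.Involutive F) (hFQ : ∀ y, F y ∈ Q ↔ y ∉ Q) : 2 * Q.ncard = Nat.card Y := by
  have hcompl : F '' Q = Qᶜ := by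
    rw [hF.image_eq_preimage_symm]
    exact Set.ext hFQ
  rw [← Set.ncard_add_ncard_compl Q, ← hcompl, Set.ncard_image_of_injective _ hF.injective, two_mul]

theorem abs_card_div_card_sub_half_le {X Y : Type*} [Finite X] [Nonempty Y] {P : X → Prop}
    {e : Y → X} (he : Function.Injective e) {F : Y → Y} (hF : Function.Involutive F)
    (hFP : ∀ y, P (e (F y)) ↔ ¬P (e y)) :
    |(Nat.card {x // P x} : ℝ) / Nat.card X - 1 / 2| ≤
      Nat.card {x // x ∉ Set.range e} / Nat.card Y := by
  have := Finite.of_injective e he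
  have hhalf : 2 * {y | P (e y)}.ncard = Nat.card Y := two_mul_ncard_of_involutive hF hFP
  have htotal : Nat.card Y + (Set.range e)ᶜ.ncard = Nat.card X := by
    rw [← Set.ncard_add_ncard_compl (Set.range e), Set.ncard_range_of_injective he]
  have hsplit : {y | P (e y)}.ncard + ({x | P x} \ Set.range e).ncard = {x | P x}.ncard := by
    rw [← Set.ncard_inter_add_ncard_sdiff_eq_ncard {x | P x} (Set.range e),
      ← Set.image_preimage_eq_inter_range, Set.ncard_image_of_injective _ he]
    rfl
  have hdiff : ({x | P x} \ Set.range e).ncard ≤ (Set.range e)ᶜ.ncard :=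
    Set.ncard_le_ncard fun x hx => hx.2
  have hY : 0 < Nat.card Y := Nat.card_pos
  change |({x | P x}.ncard : ℝ) / Nat.card X - 1 / 2| ≤ (Set.range e)ᶜ.ncard / Nat.card Y
  rify at hhalf htotal hsplit hdiff hY
  have hX : (Nat.card Y : ℝ) ≤ Nat.card X := by
    linarith [Nat.cast_nonneg (α := ℝ) (Set.range e)ᶜ.ncard]
  have herror : (({x | P x}.ncard : ℝ) / Nat.card X - 1 / 2) * Nat.card X =
      ({x | P x} \ Set.range e).ncard - (Set.range e)ᶜ.ncard / 2 := by
    rw [sub_mul, div_mul_cancel₀ _ (hY.trans_le hX).ne']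
    linarith
  rw [le_div_iff₀ hY]
  refine (mul_le_mul_of_nonneg_left hX (abs_nonneg _)).trans ?_
  rw [← abs_of_pos (hY.trans_le hX), ← abs_mul, abs_of_pos (hY.trans_le hX), herror, abs_le]
  constructor <;> linarith [Nat.cast_nonneg (α := ℝ) ({x | P x} \ Set.range e).ncard]

end Halving

section SplitExtension

variable {G S : Type*} [Group G] [Group S] {p : G →* S} {s : S →* G}

/-- The endomorphisms of `G` inducing conjugation by `τ` on the quotient `p : G →* S`. -/
def EndOver (p : G →* S) (τ : S) : Type _ :=
  {φ : G →* G // p.comp φ = (MulAut.conj τ).toMonoidHom.comp p}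

instance [Finite G] (τ : S) : Finite (EndOver p τ) :=
  Subtype.finite

theorem EndOver.map_apply {τ : S} (φ : EndOver p τ) (w : G) : p (φ.1 w) = τ * p w * τ⁻¹ :=
  DFunLike.congr_fun φ.2 w

theorem commute_of_forall_mem_mul_self {N : Subgroup G} (hN : ∀ x ∈ N, x * x = 1) {x y : G}
    (hx : x ∈ N) (hy : y ∈ N) : Commute x y := by
  have hinv {u : G} (hu : u ∈ N) : u⁻¹ = u := inv_eq_of_mul_eq_one_left (hN u hu)
  rw [Commute, SemiconjBy, ← hinv (mul_mem hx hy), mul_inv_rev, hinv hx, hinv hy]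

theorem EndOver.map_mem_center (hs : p.comp s = MonoidHom.id S) (hp : ∀ x ∈ p.ker, x * x = 1)
    {z : G} (hz : z ∈ Subgroup.center G) (hpz : z ∈ p.ker) {τ : S} (φ : EndOver p τ) :
    φ.1 z ∈ Subgroup.center G := by
  have hps (σ : S) : p (s σ) = σ := DFunLike.congr_fun hs σ
  refine Subgroup.mem_center_iff.2 fun g => ?_
  have himage (w : G) : Commute (φ.1 w) (φ.1 z) := by
    rw [Commute, SemiconjBy, ← map_mul, ← map_mul, Subgroup.mem_center_iff.1 hz]
  have hker : Commute (g * (φ.1 (s (τ⁻¹ * p g * τ)))⁻¹) (φ.1 z) := by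
    refine commute_of_forall_mem_mul_self hp ?_ ?_
    · simp [MonoidHom.mem_ker, φ.map_apply, hps, mul_assoc]
    · simp [MonoidHom.mem_ker, φ.map_apply, MonoidHom.mem_ker.1 hpz]
  simpa only [inv_mul_cancel_right] using (hker.mul_left (himage (s (τ⁻¹ * p g * τ)))).eq

/-- For an extension `p` split by `s` with kernel of exponent two, the endomorphism obtained from
`φ` by multiplying `φ (k * s σ)`, for `k` in the kernel, by the `s τ`-conjugate of `k`. -/
def EndOver.twist (hs : p.comp s = MonoidHom.id S) (hp : ∀ x ∈ p.ker, x * x = 1) {τ : S}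
    (φ : EndOver p τ) : EndOver p τ :=
  have hps (σ : S) : p (s σ) = σ := DFunLike.congr_fun hs σ
  ⟨MonoidHom.mk' (fun w => s τ * (w * (s (p w))⁻¹) * (s τ)⁻¹ * φ.1 w) fun v w => by
    have hcomm : Commute (φ.1 v * (s (τ * p v * τ⁻¹))⁻¹)
        (s (τ * p v) * (w * (s (p w))⁻¹) * (s (τ * p v))⁻¹) :=
      commute_of_forall_mem_mul_self hp (by simp [MonoidHom.mem_ker, hps, φ.map_apply])
        (by simp [MonoidHom.mem_ker, hps])
    calc s τ * (v * w * (s (p (v * w)))⁻¹) * (s τ)⁻¹ * φ.1 (v * w)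
        = s τ * (v * (s (p v))⁻¹) * (s τ)⁻¹ *
            ((s (τ * p v) * (w * (s (p w))⁻¹) * (s (τ * p v))⁻¹) *
              (φ.1 v * (s (τ * p v * τ⁻¹))⁻¹)) * s (τ * p v * τ⁻¹) * φ.1 w := by
          simp only [map_mul, map_inv]
          group
      _ = s τ * (v * (s (p v))⁻¹) * (s τ)⁻¹ * φ.1 v *
            (s τ * (w * (s (p w))⁻¹) * (s τ)⁻¹ * φ.1 w) := by
          rw [← hcomm.eq]
          simp only [map_mul, map_inv]
          group, MonoidHom.ext fun w => by simp [hps, φ.map_apply]⟩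

variable (hs : p.comp s = MonoidHom.id S) (hp : ∀ x ∈ p.ker, x * x = 1)

theorem EndOver.twist_apply {τ : S} (φ : EndOver p τ) (w : G) :
    (φ.twist hs hp).1 w = s τ * (w * (s (p w))⁻¹) * (s τ)⁻¹ * φ.1 w :=
  rfl

theorem EndOver.twist_involutive {τ : S} :
    Function.Involutive (EndOver.twist hs hp : EndOver p τ → EndOver p τ) := fun φ => by
  have hps (σ : S) : p (s σ) = σ := DFunLike.congr_fun hs σ
  refine Subtype.ext (MonoidHom.ext fun w => ?_)
  rw [twist_apply, twist_apply, ← mul_assoc,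
    hp _ (by simp [MonoidHom.mem_ker, hps]), one_mul]

theorem EndOver.twist_apply_of_mem_center {z : G} (hz : z ∈ Subgroup.center G) (hpz : z ∈ p.ker)
    {τ : S} (φ : EndOver p τ) : (φ.twist hs hp).1 z = z * φ.1 z := by
  rw [twist_apply, MonoidHom.mem_ker.1 hpz, map_one, inv_one, mul_one,
    Subgroup.mem_center_iff.1 hz, mul_inv_cancel_right]

theorem endOver_val_injective (hp : Function.Surjective p) (hS : Subgroup.center S = ⊥) :
    Function.Injective fun φ : Σ τ, EndOver p τ => φ.2.1 := by
  rintro ⟨τ, φ, hφ⟩ ⟨τ', φ', hφ'⟩ (rfl : φ = φ')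
  obtain rfl : τ = τ' := by
    rw [← inv_mul_eq_one, ← Subgroup.mem_bot, ← hS, Subgroup.mem_center_iff]
    intro σ
    obtain ⟨w, rfl⟩ := hp σ
    have h : τ * p w * τ⁻¹ = τ' * p w * τ'⁻¹ := DFunLike.congr_fun (hφ.symm.trans hφ') w
    rw [mul_inv_eq_iff_eq_mul] at h
    rw [mul_assoc, eq_inv_mul_iff_mul_eq, ← mul_assoc, h]
    group
  rfl

end SplitExtension

theorem abs_probCenterLeKer_sub_half_le {G : Type} {S : Type*} [Group G] [Finite G] [Group S]
    [Finite S] {p : G →* S} {s : S →* G} (hs : p.comp s = MonoidHom.id S)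
    (hp : ∀ x ∈ p.ker, x * x = 1) (hS : Subgroup.center S = ⊥) {z : G} (hz : z ≠ 1)
    (hcenter : (Subgroup.center G : Set G) = {1, z}) :
    |probCenterLeKer G - 1 / 2| ≤
      Nat.card {φ : G →* G // ∀ τ, p.comp φ ≠ (MulAut.conj τ).toMonoidHom.comp p} /
        Nat.card S := by
  have hps (σ : S) : p (s σ) = σ := DFunLike.congr_fun hs σ
  have hsurj : Function.Surjective p := fun σ => ⟨s σ, hps σ⟩
  have hmem (x : G) : x ∈ Subgroup.center G ↔ x = 1 ∨ x = z := Set.ext_iff.1 hcenter x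
  have hzc : z ∈ Subgroup.center G := (hmem z).2 (Or.inr rfl)
  have hpz : z ∈ p.ker := by
    rw [MonoidHom.mem_ker, ← Subgroup.mem_bot, ← hS, Subgroup.mem_center_iff]
    intro σ
    rw [← hps σ, ← map_mul, ← map_mul, Subgroup.mem_center_iff.1 hzc]
  have hker (φ : G →* G) : Subgroup.center G ≤ φ.ker ↔ φ z = 1 := by
    simp [SetLike.le_def, hmem]
  let e (φ : Σ τ, EndOver p τ) : G →* G := φ.2.1
  let F (φ : Σ τ, EndOver p τ) : Σ τ, EndOver p τ := ⟨φ.1, φ.2.twist hs hp⟩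
  have hF : Function.Involutive F := fun φ =>
    Sigma.ext rfl (heq_of_eq (EndOver.twist_involutive hs hp φ.2))
  have hFe (φ : Σ τ, EndOver p τ) : Subgroup.center G ≤ (e (F φ)).ker ↔
      ¬Subgroup.center G ≤ (e φ).ker := by
    have htwist : e (F φ) z = z * e φ z := φ.2.twist_apply_of_mem_center hs hp hzc hpz
    rw [hker, hker, htwist]
    rcases (hmem _).1 (φ.2.map_mem_center hs hp hzc hpz) with h | h
    · simp [e, h, hz]
    · simp [e, h, hz, hp z hpz]
  have hrange (φ : G →* G) : φ ∉ Set.range e ↔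
      ∀ τ, p.comp φ ≠ (MulAut.conj τ).toMonoidHom.comp p :=
    ⟨fun h τ hτ => h ⟨⟨τ, φ, hτ⟩, rfl⟩, by rintro h ⟨⟨τ, φ, hτ⟩, rfl⟩; exact h τ hτ⟩
  have inner (τ : S) : EndOver p τ :=
    ⟨(MulAut.conj (s τ)).toMonoidHom, MonoidHom.ext fun w => by simp [hps]⟩
  have hcard : Nat.card S ≤ Nat.card (Σ τ, EndOver p τ) :=
    Nat.card_le_card_of_injective (fun τ => ⟨τ, inner τ⟩) fun τ τ' h => congrArg Sigma.fst h
  have : Nonempty (Σ τ, EndOver p τ) := ⟨1, inner 1⟩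
  have hS0 : 0 < Nat.card S := Nat.card_pos
  refine (abs_card_div_card_sub_half_le (endOver_val_injective hsurj hS) hF hFe).trans ?_
  rw [Nat.card_congr (Equiv.subtypeEquivRight hrange)]
  gcongr

section SplitExtensionOfPerm

open Equiv Equiv.Perm

variable {G α : Type*} [Group G] [Fintype α] [DecidableEq α] {p : G →* Perm α} {s : Perm α →* G}

theorem mul_self_ne_one_of_isThreeCycle {c : Perm α} (hc : c.IsThreeCycle) :
    c * c ≠ 1 := fun h => by
  have := orderOf_dvd_of_pow_eq_one ((pow_two c).trans h)
  rw [hc.orderOf] at this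
  norm_num at this

theorem alternatingGroup_le_ker_of_forall_mul_self {H : Type*} [Group H] {f : Perm α →* H}
    (h : ∀ σ ∈ alternatingGroup α, f σ * f σ = 1) : alternatingGroup α ≤ f.ker := by
  rw [← closure_three_cycles_eq_alternating, Subgroup.closure_le]
  intro c hc
  have hc3 : c * (c * c) = 1 := by rw [← pow_three, ← hc.orderOf, pow_orderOf_eq_one]
  have := congrArg f hc3
  rwa [map_mul, map_mul, h c hc.mem_alternatingGroup, mul_one, map_one] at this

theorem eq_bot_of_normal_of_forall_mul_self {α : Type*} [Finite α] (hα : 5 ≤ Nat.card α)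
    {N : Subgroup (Perm α)} [N.Normal] (hN : ∀ σ ∈ N, σ * σ = 1) : N = ⊥ := by
  classical
  have := Fintype.ofFinite α
  by_contra hbot
  have hle : alternatingGroup α ≤ N :=
    alternatingGroup_le_of_normal hα ((Subgroup.nontrivial_iff_ne_bot N).2 hbot)
  rw [Nat.card_eq_fintype_card] at hα
  obtain ⟨a, b, c, hab, hac, hbc⟩ := Fintype.two_lt_card_iff.1 (show 2 < Fintype.card α by lia)
  have hcycle := isThreeCycle_swap_mul_swap_same hab hac hbc
  exact mul_self_ne_one_of_isThreeCycle hcycle (hN _ (hle hcycle.mem_alternatingGroup))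

theorem alternatingGroup_le_ker_comp_of_forall_comp_ne (hα : 7 ≤ Nat.card α)
    (hs : p.comp s = MonoidHom.id (Perm α)) (hp : ∀ x ∈ p.ker, x * x = 1) {φ : G →* G}
    (hφ : ∀ τ, p.comp φ ≠ (MulAut.conj τ).toMonoidHom.comp p) :
    alternatingGroup α ≤ (φ.comp s).ker := by
  have hps (σ : Perm α) : p (s σ) = σ := DFunLike.congr_fun hs σ
  rcases alternatingGroup_le_ker_or_exists_eq_conj hα ((p.comp φ).comp s) with h | ⟨τ, hτ⟩
  · exact alternatingGroup_le_ker_of_forall_mul_self fun σ hσ => hp _ (h hσ)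
  · have hsurj : Function.Surjective (p.comp φ) := fun σ => by
      obtain ⟨ρ, hρ⟩ := (MulAut.conj τ).surjective σ
      exact ⟨s ρ, (DFunLike.congr_fun hτ ρ).trans hρ⟩
    have : (p.ker.map (p.comp φ)).Normal := p.normal_ker.map _ hsurj
    have hbot : p.ker.map (p.comp φ) = ⊥ := by
      refine eq_bot_of_normal_of_forall_mul_self (by lia) ?_
      rintro _ ⟨x, hx, rfl⟩
      rw [← map_mul, hp x hx, map_one]
    refine absurd (MonoidHom.ext fun w => ?_) (hφ τ)
    have hw : (p.comp φ) (w * (s (p w))⁻¹) = 1 := by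
      rw [← Subgroup.mem_bot, ← hbot]
      exact ⟨_, by simp [MonoidHom.mem_ker, hps], rfl⟩
    rw [map_mul, map_inv, mul_inv_eq_one] at hw
    exact hw.trans (DFunLike.congr_fun hτ (p w))

theorem card_monoidHom_le_card_ker_pow_mul {Q H S : Type*} [Group Q] [Finite Q] [Group H]
    [Finite H] [Group S] [Finite S] (p : H →* S) :
    Nat.card (Q →* H) ≤ Nat.card p.ker ^ Nat.card Q * Nat.card (Q →* S) := by
  rw [← Nat.card_fun, ← Nat.card_prod]
  have hlift (x : H) : p (Function.invFun p (p x)) = p x := Function.invFun_eq ⟨x, rfl⟩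
  let f (ψ : Q →* H) : (Q → p.ker) × (Q →* S) :=
    (fun q => ⟨ψ q * (Function.invFun p (p (ψ q)))⁻¹, by simp [MonoidHom.mem_ker, hlift]⟩,
      p.comp ψ)
  refine Nat.card_le_card_of_injective f fun ψ ψ' h => MonoidHom.ext fun q => ?_
  obtain ⟨hker, hcomp⟩ := Prod.ext_iff.1 h
  have hq : p (ψ q) = p (ψ' q) := DFunLike.congr_fun hcomp q
  have : ψ q * (Function.invFun p (p (ψ q)))⁻¹ = ψ' q * (Function.invFun p (p (ψ' q)))⁻¹ :=
    congrArg Subtype.val (congrFun hker q)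
  rwa [hq, mul_left_inj] at this

theorem card_forall_comp_ne_le [Finite G] (hα : 7 ≤ Nat.card α)
    (hs : p.comp s = MonoidHom.id (Perm α)) (hp : ∀ x ∈ p.ker, x * x = 1) {Q : Type*} [Group Q]
    [Finite Q] {j : Q →* G} (hj : (alternatingGroup α).map s ⊔ j.range = ⊤) :
    Nat.card {φ : G →* G // ∀ τ, p.comp φ ≠ (MulAut.conj τ).toMonoidHom.comp p} ≤
      Nat.card (Q →* G) := by
  refine Nat.card_le_card_of_injective (fun φ => φ.1.comp j) fun φ ψ h => Subtype.ext ?_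
  have hle : (alternatingGroup α).map s ⊔ j.range ≤ φ.1.eqLocus ψ.1 := by
    refine sup_le ?_ ?_
    · rintro _ ⟨σ, hσ, rfl⟩
      exact (alternatingGroup_le_ker_comp_of_forall_comp_ne hα hs hp φ.2 hσ).trans
        (alternatingGroup_le_ker_comp_of_forall_comp_ne hα hs hp ψ.2 hσ).symm
    · rintro _ ⟨q, rfl⟩
      exact DFunLike.congr_fun h q
  exact MonoidHom.ext fun w => hle (hj ▸ Subgroup.mem_top w)

end SplitExtensionOfPerm

section Generation

open Equiv Equiv.Perm

variable {G α : Type*} [Group G]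

/-- The homomorphism from the group with two elements sending the nontrivial element to an
involution `x`. -/
def involutionHom (x : G) (hx : x * x = 1) : ℤˣ →* G :=
  MonoidHom.mk' (fun ε => if ε = 1 then 1 else x) fun ε δ => by
    rcases Int.units_eq_one_or ε with rfl | rfl <;> rcases Int.units_eq_one_or δ with rfl | rfl <;>
      simp [hx]

theorem involutionHom_neg_one {x : G} (hx : x * x = 1) : involutionHom x hx (-1) = x :=
  rfl

theorem commute_involutionHom {x y : G} (hx : x * x = 1) (hy : y * y = 1) (hxy : Commute x y)
    (ε δ : ℤˣ) : Commute (involutionHom x hx ε) (involutionHom y hy δ) := by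
  rcases Int.units_eq_one_or ε with rfl | rfl <;> rcases Int.units_eq_one_or δ with rfl | rfl <;>
    simp [involutionHom_neg_one, hxy]

variable [Fintype α] [DecidableEq α]

theorem alternatingGroup_sup_zpowers_swap {a b : α} (hab : a ≠ b) :
    alternatingGroup α ⊔ Subgroup.zpowers (swap a b) = ⊤ := by
  refine (Subgroup.eq_top_iff' _).2 fun σ => ?_
  rcases Int.units_eq_one_or (sign σ) with hσ | hσ
  · exact Subgroup.mem_sup_left (mem_alternatingGroup.2 hσ)
  · rw [← mul_swap_mul_self a b σ]
    refine mul_mem (Subgroup.mem_sup_left (mem_alternatingGroup.2 ?_))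
      (Subgroup.mem_sup_right (Subgroup.mem_zpowers _))
    rw [Perm.sign_mul, hσ, sign_swap hab, neg_mul_neg, one_mul]

theorem exists_map_alternatingGroup_sup_range_eq_top {s : Perm α →* G} {x : G} (hx : x * x = 1)
    (hgen : s.range ⊔ Subgroup.zpowers x = ⊤) {a b : α} (hab : a ≠ b)
    (hcomm : Commute x (s (swap a b))) :
    ∃ j : ℤˣ × ℤˣ →* G, (alternatingGroup α).map s ⊔ j.range = ⊤ := by
  have hswap : s (swap a b) * s (swap a b) = 1 := by rw [← map_mul, swap_mul_self, map_one]
  let j : ℤˣ × ℤˣ →* G := (involutionHom x hx).noncommCoprod (involutionHom _ hswap)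
    (commute_involutionHom hx hswap hcomm)
  refine ⟨j, top_unique ?_⟩
  rw [← hgen, MonoidHom.range_eq_map, ← alternatingGroup_sup_zpowers_swap hab, Subgroup.map_sup,
    MonoidHom.map_zpowers, sup_assoc]
  refine sup_le_sup_left (sup_le ?_ ?_) _
  · rw [Subgroup.zpowers_le]
    exact ⟨(1, -1), by simp [j, involutionHom_neg_one]⟩
  · rw [Subgroup.zpowers_le]
    exact ⟨(-1, 1), by simp [j, involutionHom_neg_one]⟩

end Generation

section SignedPermutations

open Equiv Equiv.Perm SemidirectProduct

variable {n : ℕ}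

theorem TypeC.mul_left_apply (v w : TypeC n) (i : Fin n) :
    (v * w).left i = v.left i * w.left (v.right⁻¹ i) :=
  rfl

theorem TypeC.mul_self_of_right_eq_one {v : TypeC n} (hv : v.right = 1) : v * v = 1 := by
  refine SemidirectProduct.ext (funext fun i => ?_) (by rw [mul_right, hv, one_mul, one_right])
  rw [mul_left_apply, hv]
  exact Int.units_mul_self _

theorem TypeC.inr_mul_inl_mul_inr_inv (σ : Perm (Fin n)) (v : Fin n → ℤˣ) :
    (inr σ * inl v * (inr σ)⁻¹ : TypeC n) = inl fun i => v (σ⁻¹ i) := by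
  rw [← map_inv, ← inl_aut]
  rfl

theorem TypeC.commute_inl_inr {v : Fin n → ℤˣ} {σ : Perm (Fin n)} (h : ∀ i, v (σ i) = v i) :
    Commute (inl v : TypeC n) (inr σ) := by
  refine Commute.symm (mul_inv_eq_iff_eq_mul.1 ?_)
  rw [inr_mul_inl_mul_inr_inv]
  congr 1
  ext1 i
  exact (h _).symm.trans (congrArg v (σ.apply_symm_apply i))

/-- The central symmetry `-1` of the cube. -/
def centralInversion (n : ℕ) : TypeC n :=
  inl fun _ => -1

theorem centralInversion_mem_center : centralInversion n ∈ Subgroup.center (TypeC n) := by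
  refine Subgroup.mem_center_iff.2 fun w => SemidirectProduct.ext (funext fun i => ?_) ?_
  · rw [TypeC.mul_left_apply, TypeC.mul_left_apply]
    exact mul_comm _ _
  · simp [centralInversion]

theorem centralInversion_ne_one (hn : 0 < n) : centralInversion n ≠ 1 := fun h => by
  have : (-1 : ℤˣ) = 1 := congrFun (congrArg SemidirectProduct.left h) ⟨0, hn⟩
  exact absurd this (by decide)

theorem TypeC.eq_one_or_eq_centralInversion_of_commute (hn : 3 ≤ n) {x : TypeC n}
    (hx : ∀ σ, Commute (inr σ) x) : x = 1 ∨ x = centralInversion n := by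
  have hright : x.right = 1 := by
    rw [← Subgroup.mem_bot, ← center_perm_eq_bot (α := Fin n) (by simpa using hn),
      Subgroup.mem_center_iff]
    exact fun σ => congrArg SemidirectProduct.right (hx σ)
  have hconst (i j : Fin n) : x.left i = x.left j := by
    have := congrFun (congrArg SemidirectProduct.left (hx (swap i j)).eq) i
    simpa [mul_left_apply, hright] using this.symm
  let o : Fin n := ⟨0, by lia⟩
  rcases Int.units_eq_one_or (x.left o) with h | h
  · exact Or.inl (SemidirectProduct.ext (funext fun i => (hconst i o).trans h) hright)
  · exact Or.inr (SemidirectProduct.ext (funext fun i => (hconst i o).trans h) hright)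

theorem TypeC.inr_mul_inl_mulSingle_mul_inr_inv (σ : Perm (Fin n)) (i : Fin n) (ε : ℤˣ) :
    (inr σ * inl (Pi.mulSingle i ε) * (inr σ)⁻¹ : TypeC n) = inl (Pi.mulSingle (σ i) ε) := by
  rw [inr_mul_inl_mul_inr_inv]
  congr 1
  ext1 j
  simp [Pi.mulSingle_apply, Equiv.symm_apply_eq]

theorem TypeC.eq_top_of_inl_mulSingle_mem {K : Subgroup (TypeC n)} (hK : ∀ σ, inr σ ∈ K)
    {c : Fin n} (hc : inl (Pi.mulSingle c (-1)) ∈ K) : K = ⊤ := by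
  have hsingle (i : Fin n) (ε : ℤˣ) : (inl (Pi.mulSingle i ε) : TypeC n) ∈ K := by
    rcases Int.units_eq_one_or ε with rfl | rfl
    · simp
    · rw [← swap_apply_left c i, ← inr_mul_inl_mulSingle_mul_inr_inv]
      exact mul_mem (mul_mem (hK _) hc) (inv_mem (hK _))
  refine (Subgroup.eq_top_iff' K).2 fun w => ?_
  rw [← inl_left_mul_inr_right w, ← Finset.univ_prod_mulSingle w.left]
  exact mul_mem (Subgroup.prod_mem (K.comap inl) fun i _ => hsingle i _) (hK _)

theorem TypeC.ker_inversionSign_le {K : Subgroup (TypeC n)} (hK : ∀ σ, inr σ ∈ K) {c d : Fin n}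
    (hcd : c ≠ d) (hc : inl (Pi.mulSingle c (-1) * Pi.mulSingle d (-1)) ∈ K) :
    (inversionSign n).ker ≤ K := by
  have hpair (i : Fin n) (ε : ℤˣ) :
      (inl (Pi.mulSingle i ε * Pi.mulSingle d ε) : TypeC n) ∈ K := by
    rcases Int.units_eq_one_or ε with rfl | rfl
    · simp
    rcases eq_or_ne i d with rfl | hid
    · simp [← Pi.mulSingle_mul]
    have hconj : (inr (swap c i) * inl (Pi.mulSingle c (-1) * Pi.mulSingle d (-1)) *
        (inr (swap c i))⁻¹ : TypeC n) = inl (Pi.mulSingle i (-1) * Pi.mulSingle d (-1)) := by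
      rw [map_mul, ← conj_mul, inr_mul_inl_mulSingle_mul_inr_inv,
        inr_mul_inl_mulSingle_mul_inr_inv, swap_apply_left,
        swap_apply_of_ne_of_ne hcd.symm hid.symm, map_mul]
    rw [← hconj]
    exact mul_mem (mul_mem (hK _) hc) (inv_mem (hK _))
  intro w hw
  have hprod : ∏ i, w.left i = 1 := hw
  have hleft : w.left = ∏ i, (Pi.mulSingle i (w.left i) * Pi.mulSingle d (w.left i)) := by
    rw [Finset.prod_mul_distrib, Finset.univ_prod_mulSingle]
    have := map_prod (MonoidHom.mulSingle (fun _ : Fin n => ℤˣ) d) w.left Finset.univ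
    rw [hprod, map_one] at this
    exact (mul_eq_left.2 this.symm).symm
  rw [← inl_left_mul_inr_right w, hleft]
  exact mul_mem (Subgroup.prod_mem (K.comap inl) fun i _ => hpair i _) (hK _)

theorem inversionSign_inl (v : Fin n → ℤˣ) : inversionSign n (inl v) = ∏ i, v i :=
  rfl

theorem inr_mem_ker_inversionSign (σ : Perm (Fin n)) :
    (inr σ : TypeC n) ∈ (inversionSign n).ker := by
  rw [MonoidHom.mem_ker, ← inl_left_mul_inr_right (inr σ : TypeC n)]
  simp [inversionSign]

theorem inversionSign_centralInversion : inversionSign n (centralInversion n) = (-1) ^ n := by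
  simp [centralInversion, inversionSign_inl]

theorem center_typeD_eq_bot (hn : 3 ≤ n) (hodd : Odd n) : Subgroup.center (TypeD n) = ⊥ := by
  refine (Subgroup.eq_bot_iff_forall _).2 fun x hx => Subtype.ext ?_
  refine (TypeC.eq_one_or_eq_centralInversion_of_commute hn fun σ => ?_).resolve_right fun h => ?_
  · exact congrArg Subtype.val (Subgroup.mem_center_iff.1 hx ⟨inr σ, inr_mem_ker_inversionSign σ⟩)
  · have := MonoidHom.mem_ker.1 x.2
    rw [h, inversionSign_centralInversion, hodd.neg_one_pow] at this
    exact absurd this (by decide)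

theorem probCenterLeKer_eq_one {G : Type} [Group G] [Finite G] (h : Subgroup.center G = ⊥) :
    probCenterLeKer G = 1 := by
  rw [probCenterLeKer, Nat.card_congr (Equiv.subtypeUnivEquiv fun φ => h ▸ bot_le)]
  exact div_self (Nat.cast_ne_zero.2 Nat.card_pos.ne')

section Embedding

variable {G : Type} [Group G] {ι : G →* TypeC n}

theorem mul_self_of_mem_ker_rightHom_comp (hι : Function.Injective ι) {x : G}
    (hx : x ∈ (rightHom.comp ι).ker) : x * x = 1 :=
  hι (by rw [map_mul, map_one, TypeC.mul_self_of_right_eq_one hx])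

theorem card_ker_rightHom_comp_le (hι : Function.Injective ι) :
    Nat.card (rightHom.comp ι).ker ≤ 2 ^ n := by
  have hinj : Function.Injective fun x : (rightHom.comp ι).ker => (ι x).left := fun x y h =>
    Subtype.ext (hι (SemidirectProduct.ext h (x.2.trans y.2.symm)))
  simpa using Nat.card_le_card_of_injective _ hinj

variable {s : Perm (Fin n) →* G}

theorem coe_center_eq_pair (hι : Function.Injective ι) (hs : ∀ σ, ι (s σ) = inr σ) (hn : 3 ≤ n)
    {z : G} (hz : ι z = centralInversion n) : (Subgroup.center G : Set G) = {1, z} := by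
  refine Set.Subset.antisymm (fun x hx => ?_) (Set.insert_subset (one_mem _) ?_)
  · have hcomm (σ : Perm (Fin n)) : Commute (inr σ) (ι x) := by
      have hsx : Commute (s σ) x := Subgroup.mem_center_iff.1 hx (s σ)
      exact hs σ ▸ hsx.map ι
    refine (TypeC.eq_one_or_eq_centralInversion_of_commute hn hcomm).imp (fun h => ?_) fun h => ?_
    · exact hι (h.trans (map_one ι).symm)
    · exact hι (h.trans hz.symm)
  · rw [Set.singleton_subset_iff]
    refine Subgroup.mem_center_iff.2 fun w => hι ?_
    rw [map_mul, map_mul, hz]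
    exact Subgroup.mem_center_iff.1 centralInversion_mem_center (ι w)

theorem exists_map_alternatingGroup_sup_range_eq_top_of_inl (hι : Function.Injective ι)
    (hs : ∀ σ, ι (s σ) = inr σ) {x : G} {v : Fin n → ℤˣ} (hx : ι x = inl v)
    (hgen : s.range ⊔ Subgroup.zpowers x = ⊤) {a b : Fin n} (hab : a ≠ b) (hv : v a = v b) :
    ∃ j : ℤˣ × ℤˣ →* G, (alternatingGroup (Fin n)).map s ⊔ j.range = ⊤ := by
  have hker : x ∈ (rightHom.comp ι).ker := by
    rw [MonoidHom.mem_ker, MonoidHom.comp_apply, hx, rightHom_inl]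
  have hswap (i : Fin n) : v (swap a b i) = v i := by
    rw [swap_apply_def]
    split_ifs with hia hib
    · rw [hia, hv]
    · rw [hib, hv]
    · rfl
  refine exists_map_alternatingGroup_sup_range_eq_top (mul_self_of_mem_ker_rightHom_comp hι hker)
    hgen hab (hι ?_)
  rw [map_mul, map_mul, hs, hx]
  exact TypeC.commute_inl_inr hswap

theorem abs_probCenterLeKer_sub_half_le_pow_mul [Finite G] (hn : 7 ≤ n)
    (hι : Function.Injective ι) (hs : ∀ σ, ι (s σ) = inr σ) {z : G}
    (hz : ι z = centralInversion n) {j : ℤˣ × ℤˣ →* G}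
    (hj : (alternatingGroup (Fin n)).map s ⊔ j.range = ⊤) :
    |probCenterLeKer G - 1 / 2| ≤
      16 ^ n * (Nat.card (ℤˣ × ℤˣ →* Perm (Fin n)) / n.factorial) := by
  have hps : (rightHom.comp ι).comp s = MonoidHom.id (Perm (Fin n)) :=
    MonoidHom.ext fun σ => congrArg SemidirectProduct.right (hs σ)
  have hp : ∀ x ∈ (rightHom.comp ι).ker, x * x = 1 := fun _ =>
    mul_self_of_mem_ker_rightHom_comp hι
  have hz1 : z ≠ 1 := fun h =>
    centralInversion_ne_one (show 0 < n by lia) (by rw [← hz, h, map_one])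
  have hcard : Nat.card (ℤˣ × ℤˣ →* G) ≤ 16 ^ n * Nat.card (ℤˣ × ℤˣ →* Perm (Fin n)) :=
    calc
      _ ≤ Nat.card (rightHom.comp ι).ker ^ Nat.card (ℤˣ × ℤˣ) * _ :=
        card_monoidHom_le_card_ker_pow_mul (rightHom.comp ι)
      _ ≤ (2 ^ n) ^ 4 * _ := by
        rw [show Nat.card (ℤˣ × ℤˣ) = 4 by simp]
        gcongr
        exact card_ker_rightHom_comp_le hι
      _ = 16 ^ n * _ := by rw [pow_right_comm]; norm_num
  calc
    |probCenterLeKer G - 1 / 2| ≤ _ / (Nat.card (Perm (Fin n)) : ℝ) :=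
      abs_probCenterLeKer_sub_half_le hps hp (center_perm_eq_bot (by simp; lia)) hz1
        (coe_center_eq_pair hι hs (by lia) hz)
    _ ≤ Nat.card (ℤˣ × ℤˣ →* G) / (Nat.card (Perm (Fin n)) : ℝ) := by
      gcongr
      exact card_forall_comp_ne_le (by simpa using hn) hps hp hj
    _ ≤ (16 ^ n * Nat.card (ℤˣ × ℤˣ →* Perm (Fin n)) : ℕ) / (Nat.card (Perm (Fin n)) : ℝ) := by
      gcongr
    _ = _ := by
      rw [Nat.card_perm, Nat.card_fin]
      push_cast
      ring

end Embedding

theorem abs_probCenterLeKer_typeC_sub_half_le (hn : 7 ≤ n) :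
    |probCenterLeKer (TypeC n) - 1 / 2| ≤
      16 ^ n * (Nat.card (ℤˣ × ℤˣ →* Perm (Fin n)) / n.factorial) := by
  let a : Fin n := ⟨0, by lia⟩
  let b : Fin n := ⟨1, by lia⟩
  let c : Fin n := ⟨2, by lia⟩
  have hgen : (inr : Perm (Fin n) →* TypeC n).range ⊔
      Subgroup.zpowers (inl (Pi.mulSingle c (-1))) = ⊤ :=
    TypeC.eq_top_of_inl_mulSingle_mem (fun σ => Subgroup.mem_sup_left ⟨σ, rfl⟩)
      (Subgroup.mem_sup_right (Subgroup.mem_zpowers _))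
  obtain ⟨j, hj⟩ := exists_map_alternatingGroup_sup_range_eq_top_of_inl
    (ι := MonoidHom.id (TypeC n)) Function.injective_id (fun _ => rfl) rfl hgen
    (a := a) (b := b) (by simp [a, b]) (by simp [a, b, c])
  exact abs_probCenterLeKer_sub_half_le_pow_mul (ι := MonoidHom.id (TypeC n)) hn
    Function.injective_id (fun _ => rfl) rfl hj

theorem abs_probCenterLeKer_typeD_sub_half_le (hn : 7 ≤ n) (heven : Even n) :
    |probCenterLeKer (TypeD n) - 1 / 2| ≤
      16 ^ n * (Nat.card (ℤˣ × ℤˣ →* Perm (Fin n)) / n.factorial) := by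
  let a : Fin n := ⟨0, by lia⟩
  let b : Fin n := ⟨1, by lia⟩
  let c : Fin n := ⟨2, by lia⟩
  let d : Fin n := ⟨3, by lia⟩
  let s : Perm (Fin n) →* TypeD n := inr.codRestrict _ inr_mem_ker_inversionSign
  let x : TypeD n := ⟨inl (Pi.mulSingle c (-1) * Pi.mulSingle d (-1)), by
    simp [MonoidHom.mem_ker, inversionSign_inl]⟩
  have hgen : s.range ⊔ Subgroup.zpowers x = ⊤ := by
    have hle := TypeC.ker_inversionSign_le
      (K := (s.range ⊔ Subgroup.zpowers x).map (inversionSign n).ker.subtype)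
      (fun σ => ⟨s σ, Subgroup.mem_sup_left ⟨σ, rfl⟩, rfl⟩) (show c ≠ d by simp [c, d])
      ⟨x, Subgroup.mem_sup_right (Subgroup.mem_zpowers x), rfl⟩
    refine (Subgroup.eq_top_iff' _).2 fun w => ?_
    obtain ⟨y, hy, hyw⟩ := hle w.2
    exact Subtype.ext hyw ▸ hy
  obtain ⟨j, hj⟩ := exists_map_alternatingGroup_sup_range_eq_top_of_inl
    (ι := (inversionSign n).ker.subtype) Subtype.val_injective (fun _ => rfl) rfl hgen
    (a := a) (b := b) (by simp [a, b]) (by simp [a, b, c, d])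
  have hz : centralInversion n ∈ (inversionSign n).ker := by
    rw [MonoidHom.mem_ker, inversionSign_centralInversion, heven.neg_one_pow]
  exact abs_probCenterLeKer_sub_half_le_pow_mul (ι := (inversionSign n).ker.subtype)
    (z := ⟨_, hz⟩) hn Subtype.val_injective (fun _ => rfl) rfl hj

end SignedPermutations

section Limits

open Equiv

theorem tendsto_half_of_abs_sub_half_le {u : ℕ → ℝ} {k : ℕ → ℕ} (hk : Tendsto k atTop atTop)
    (h : ∀ n, 7 ≤ k n → |u n - 1 / 2| ≤
      16 ^ k n * (Nat.card (ℤˣ × ℤˣ →* Perm (Fin (k n))) / (k n).factorial)) :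
    Tendsto u atTop (𝓝 (1 / 2)) := by
  have hbound := tendsto_pow_mul_card_monoidHom_perm_div_factorial (ℤˣ × ℤˣ)
    (show (0 : ℝ) ≤ 16 by norm_num)
  rw [tendsto_iff_norm_sub_tendsto_zero]
  refine squeeze_zero' (Eventually.of_forall fun _ => norm_nonneg _) ?_ (hbound.comp hk)
  filter_upwards [hk.eventually_ge_atTop 7] with n hn using h n hn

theorem tendsto_probCenterLeKer_one_of_center_eq_bot {G : ℕ → Type} [∀ n, Group (G n)]
    [∀ n, Finite (G n)] (h : ∀ᶠ n in atTop, Subgroup.center (G n) = ⊥) :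
    Tendsto (fun n => probCenterLeKer (G n)) atTop (𝓝 1) :=
  tendsto_const_nhds.congr' (h.mono fun _ hn => (probCenterLeKer_eq_one hn).symm)

end Limits

theorem theorem5 :
    Tendsto (fun n : ℕ => probCenterLeKer (TypeC n)) atTop (𝓝 (1 / 2)) ∧
    Tendsto (fun n : ℕ => probCenterLeKer (TypeD (2 * n))) atTop (𝓝 (1 / 2)) ∧
    Tendsto (fun n : ℕ => probCenterLeKer (TypeD (2 * n + 1))) atTop (𝓝 1) ∧
    Tendsto (fun n : ℕ => probCenterLeKer (TypeA n)) atTop (𝓝 1) ∧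
    (∀ n : ℕ, 1 ≤ n → Subgroup.center (TypeD (2 * n + 1)) = ⊥) ∧
    (∀ n : ℕ, 2 ≤ n → Subgroup.center (TypeA n) = ⊥) := by
  have hD (n : ℕ) (hn : 1 ≤ n) : Subgroup.center (TypeD (2 * n + 1)) = ⊥ :=
    center_typeD_eq_bot (by lia) (odd_two_mul_add_one n)
  have hA (n : ℕ) (hn : 2 ≤ n) : Subgroup.center (TypeA n) = ⊥ :=
    center_perm_eq_bot (by rw [Nat.card_fin]; lia)
  have hk : Tendsto (fun n : ℕ => 2 * n) atTop atTop := tendsto_id.const_mul_atTop' two_pos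
  refine ⟨?_, ?_, ?_, ?_, hD, hA⟩
  · exact tendsto_half_of_abs_sub_half_le tendsto_id fun _ => abs_probCenterLeKer_typeC_sub_half_le
  · exact tendsto_half_of_abs_sub_half_le hk fun n hn =>
      abs_probCenterLeKer_typeD_sub_half_le hn (even_two_mul n)
  · exact tendsto_probCenterLeKer_one_of_center_eq_bot ((eventually_ge_atTop 1).mono hD)
  · exact tendsto_probCenterLeKer_one_of_center_eq_bot ((eventually_ge_atTop 2).mono hA)
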